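/- For a group $G$ let $\Delta_G=\bigsqcup_{K} G/K$, where $K$ runs over the finite subgroups of $G$, and let $\mathbb{Z}\Delta_G$ be the corresponding permutation module. A short exact sequence of $\mathbb{Z}G$-modules is called $\mathfrak{F}$-split if it splits, as a sequence of $\mathbb{Z}G$-modules, after applying $-\otimes_{\mathbb{Z}}\mathbb{Z}\Delta_G$ (with diagonal $G$-action); a longer exact sequence is $\mathfrak{F}$-split if it is spliced from $\mathfrak{F}$-split short exact sequences. A $\mathbb{Z}G$-module is $\mathfrak{F}$-projective if it is a direct summand of $M\otimes_{\mathbb{Z}}\mathbb{Z}\Delta_G$ for some $\mathbb{Z}G$-module $M$. The $\mathfrak{F}$-cohomological dimension $\mathfrak{F}\mathrm{cd}\,G\in\mathbb{N}\cup\{\infty\}$ is the least $n$ for which there is an $\mathfrak{F}$-split exact sequence $0\to P_n\to\cdots\to P_0\to\mathbb{Z}\to 0$ of $\mathbb{Z}G$-modules with all $P_i$ $\mathfrak{F}$-projective and $\mathbb{Z}$ the trivial module ($\infty$ if there is no such $n$). Proposition. Let $N\hookrightarrow G\twoheadrightarrow Q$ be a group extension and let $m,n\in\mathbb{N}$ with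 $\mathfrak{F}\mathrm{cd}\,Q\le m$. Assume that every finite extension $H$ of $N$ contained in $G$, that is, every subgroup $H\le G$ with $N\le H$ and $|H:N|<\infty$, satisfies $\mathfrak{F}\mathrm{cd}\,H\le n$. (This holds in particular if every group $H$ containing $N$ as a normal subgroup of finite index satisfies $\mathfrak{F}\mathrm{cd}\,H\le n$.) Then $\mathfrak{F}\mathrm{cd}\,G\le n+m$. -/

import Mathlib

universe u

/-- The standard `G`-set `Δ` attached to the family of finite subgroups: the disjoint union of the
coset spaces `G ⧸ K`, where `K` runs over the finite subgroups of `G`. -/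
abbrev FinCosets (G : Type u) [Group G] : Type u :=
  Σ K : {K : Subgroup G // Finite K}, G ⧸ K.1

/-- The permutation module `kΔ` on the disjoint union `Δ` of all `G ⧸ K` with `K` finite. -/
noncomputable abbrev permFin (k : Type) [CommRing k] (G : Type u) [Group G] : Rep.{u} k G :=
  Rep.ofMulAction k G (FinCosets G)

/-- The `kG`-module `M ⊗ kΔ`: tensor product over `k`, diagonal action. -/
noncomputable abbrev tensorPerm {k : Type} [CommRing k] {G : Type u} [Group G]
    (M : Rep.{u} k G) : Rep.{u} k G :=
  Rep.of (M.ρ.tprod (permFin k G).ρ)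

/-- The map `f ⊗ kΔ` induced by a map `f` of `kG`-modules. -/
noncomputable abbrev tensorPermMap {k : Type} [CommRing k] {G : Type u} [Group G]
    {A B : Rep.{u} k G} (f : A ⟶ B) : tensorPerm A ⟶ tensorPerm B :=
  Rep.ofHom (f.hom.rTensor (permFin k G).ρ)

/-- A sequence `A → B → C` of `kG`-modules is an `𝔉`-split short exact sequence if
`0 → A → B → C → 0` is exact and splits after tensoring with `kΔ` over `k`, i.e. the surjection
`B ⊗ kΔ → C ⊗ kΔ` has a `kG`-linear section. -/
def IsFSplit {k : Type} [CommRing k] {G : Type u} [Group G] {A B C : Rep.{u} k G}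
    (i : A ⟶ B) (p : B ⟶ C) : Prop :=
  Function.Injective i.hom ∧ Function.Exact i.hom p.hom ∧ Function.Surjective p.hom ∧
    ∃ s : tensorPerm C ⟶ tensorPerm B,
      CategoryTheory.CategoryStruct.comp s (tensorPermMap p) =
        CategoryTheory.CategoryStruct.id (tensorPerm C)

/-- A `kG`-module is `𝔉`-projective if it is a direct summand of `M ⊗ kΔ` for some
`kG`-module `M`. -/
def IsFProjective {k : Type} [CommRing k] {G : Type u} [Group G] (P : Rep.{u} k G) : Prop :=
  ∃ M : Rep.{u} k G, Nonempty (CategoryTheory.Retract P (tensorPerm M))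

/-- `HasFResolution n M`: there is an `𝔉`-split exact sequence
`0 → P_n → ⋯ → P_0 → M → 0` with all `P_i` `𝔉`-projective. For `n = 0` this says that `M` is
`𝔉`-projective; a sequence of length `n + 1` is an `𝔉`-split short exact sequence
`0 → K → P_0 → M → 0` spliced with such a sequence of length `n` for `K`. -/
def HasFResolution {k : Type} [CommRing k] {G : Type u} [Group G] : ℕ → Rep.{u} k G → Prop
  | 0, M => IsFProjective M
  | n + 1, M => ∃ (K P : Rep.{u} k G) (i : K ⟶ P) (p : P ⟶ M),
      IsFSplit i p ∧ IsFProjective P ∧ HasFResolution n K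

/-- The `𝔉`-projective dimension of a `kG`-module: the least length of an `𝔉`-projective
resolution, and `⊤` if there is none of finite length. -/
noncomputable def fpd {k : Type} [CommRing k] {G : Type u} [Group G] (M : Rep.{u} k G) : ℕ∞ :=
  ⨅ (n : ℕ) (_ : HasFResolution n M), (n : ℕ∞)

/-- The `𝔉`-cohomological dimension of `G`: the `𝔉`-projective dimension of the trivial
`ℤG`-module `ℤ`. -/
noncomputable def fcd (G : Type u) [Group G] : ℕ∞ :=
  fpd (Rep.trivial ℤ G (ULift.{u} ℤ))

/-! Being `𝔉`-split amounts to being split over each finite subgroup (`IsFinSplit`), and the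
`𝔉`-projectives are the modules lifting along such surjections (`isFProjective_iff`). Let `J` be the
kernel of the augmentation `kΔ_G → k`. The sequence `0 → M ⊗ J → M ⊗ kΔ_G → M → 0` is `𝔉`-split with
`𝔉`-projective middle term, so by Schanuel's lemma lengths of resolutions are measured by
projectivity of `M ⊗ J^{⊗n}` (`IsFinProjective.syzygyRes_succ`,
`HasFResolution.of_isFinProjective`).

All this survives restriction of `kΔ_G` to a subgroup `H`, so `fcd H ≤ n` makes `J^{⊗n}` projective
over `H`. Apply this to the preimages `H` of finite subgroups of `Q`. An `𝔉`-projective `Q`-module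
is a summand of some `M ⊗ kΔ_Q`; its inflation tensored with `J^{⊗n}` is `𝔉`-projective over `G`,
because lifts over the stabilizers of `Δ_Q`, which are such `H`, assemble orbit by orbit
(`IsFinProjective.tprod_ofMulAction`). Shifting along a resolution over `Q` of length `a ≤ m` shows
that `J^{⊗(n+a)}` is `𝔉`-projective over `G`. -/

open scoped TensorProduct

namespace Representation

/-! ### Surjections split over every finite subgroup -/

section Basic

variable {k : Type*} [CommRing k] {G H : Type*} [Group G] [Group H]
variable {U V W : Type*} [AddCommGroup U] [Module k U] [AddCommGroup V] [Module k V]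
  [AddCommGroup W] [Module k W]
variable {ρ : Representation k G U} {σ : Representation k G V} {τ : Representation k G W}

/-- An intertwining map, viewed as an intertwining map of the representations pulled back along a
group homomorphism. -/
def IntertwiningMap.pullback (p : σ.IntertwiningMap τ) (φ : H →* G) :
    IntertwiningMap (σ.comp φ : Representation k H V) (τ.comp φ : Representation k H W) :=
  ⟨p.toLinearMap, fun h => p.isIntertwining' (φ h)⟩

/-- An intertwining map is finitely split if it has, for every finite subgroup `K`, a linear
section commuting with the action of `K`. -/
def IsFinSplit (p : σ.IntertwiningMap τ) : Prop :=
  ∀ K : Subgroup G, Finite K → ∃ s : W →ₗ[k] V, (∀ w, p (s w) = w) ∧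
    ∀ g ∈ K, ∀ w, s (τ g w) = σ g (s w)

lemma IsFinSplit.exists_section {p : σ.IntertwiningMap τ} (hp : IsFinSplit p) :
    ∃ s : W →ₗ[k] V, ∀ w, p (s w) = w :=
  (hp ⊥ inferInstance).imp fun _ h => h.1

lemma IsFinSplit.surjective {p : σ.IntertwiningMap τ} (hp : IsFinSplit p) :
    Function.Surjective p :=
  fun w => hp.exists_section.elim fun s hs => ⟨s w, hs w⟩

/-- Images of finite subgroups are finite. Injectivity of `φ` is not needed, so inflation along `G →
Q` is covered. -/
lemma IsFinSplit.pullback {p : σ.IntertwiningMap τ} (hp : IsFinSplit p) (φ : H →* G) :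
    IsFinSplit (p.pullback φ) := by
  intro K hK
  obtain ⟨s, hs, hs'⟩ := hp (K.map φ) ((Set.toFinite (K : Set H)).image φ)
  exact ⟨s, hs, fun h hh w => hs' (φ h) (Subgroup.mem_map_of_mem φ hh) w⟩

lemma IsFinSplit.rTensor {p : σ.IntertwiningMap τ} (hp : IsFinSplit p) :
    IsFinSplit (p.rTensor ρ) := by
  intro K hK
  obtain ⟨s, hs, hs'⟩ := hp K hK
  refine ⟨s.rTensor U, fun w => ?_, fun g hg w => ?_⟩
  · induction w with
    | zero => simp
    | tmul x y => simp [hs]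
    | add x y hx hy => simp only [map_add, hx, hy]
  · induction w with
    | zero => simp
    | tmul x y => simp [hs' g hg]
    | add x y hx hy => simp only [map_add, hx, hy]

/-- An intertwining map that vanishes after composing with `p` factors through the kernel `i`
of `p`. -/
lemma IntertwiningMap.exists_comp_eq_of_exact {X : Type*} [AddCommGroup X] [Module k X]
    {ξ : Representation k G X} {i : ρ.IntertwiningMap σ} {p : σ.IntertwiningMap τ}
    (hi : Function.Injective i) (hip : Function.Exact i p) (f : ξ.IntertwiningMap σ)
    (hf : ∀ x, p (f x) = 0) : ∃ g : ξ.IntertwiningMap ρ, ∀ x, i (g x) = f x := by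
  choose g hg using fun x => (hip (f x)).1 (hf x)
  refine ⟨LinearMap.intertwiningMap_of_isIntertwiningMap ξ ρ
    { toFun := g
      map_add' := fun x y => hi (by simp [hg])
      map_smul' := fun c x => hi (by simp [hg]) } fun a x => hi ?_, hg⟩
  change i (g _) = i (ρ a (g x))
  rw [hg, i.isIntertwining, hg, f.isIntertwining]

end Basic

/-! ### Relative projectivity and Schanuel's lemma -/

section Projective

variable {k : Type*} [CommRing k] {G H : Type*} [Group G] [Group H]
variable {A P M L : Type u} [AddCommGroup A] [Module k A] [AddCommGroup P] [Module k P]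
  [AddCommGroup M] [Module k M] [AddCommGroup L] [Module k L]

/-- A representation is finitely projective if maps out of it lift along all finitely split
intertwining maps. -/
def IsFinProjective (ρ : Representation k G P) : Prop :=
  ∀ ⦃B C : Type u⦄ [AddCommGroup B] [Module k B] [AddCommGroup C] [Module k C]
    ⦃σ : Representation k G B⦄ ⦃τ : Representation k G C⦄ (p : σ.IntertwiningMap τ),
    IsFinSplit p → ∀ f : ρ.IntertwiningMap τ, ∃ l : ρ.IntertwiningMap σ, ∀ x, p (l x) = f x

variable {ρ : Representation k G P} {α : Representation k G A} {μ : Representation k G M}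
  {τ : Representation k G L}

lemma IsFinProjective.of_retract (hρ : IsFinProjective ρ) (i : α.IntertwiningMap ρ)
    (r : ρ.IntertwiningMap α) (h : ∀ x, r (i x) = x) : IsFinProjective α := by
  intro B C _ _ _ _ σ τ p hp f
  obtain ⟨l, hl⟩ := hρ p hp (f.comp r)
  exact ⟨l.comp i, fun x => by simp [hl, h]⟩

lemma IsFinProjective.of_equiv (hρ : IsFinProjective ρ) (e : ρ.Equiv α) : IsFinProjective α :=
  hρ.of_retract e.symm.toIntertwiningMap e.toIntertwiningMap fun x => e.apply_symm_apply x

lemma IsFinProjective.of_finite [Finite G] (ρ : Representation k G P) : IsFinProjective ρ := by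
  intro B C _ _ _ _ σ τ p hp f
  obtain ⟨s, hs, hs'⟩ := hp ⊤ inferInstance
  exact ⟨LinearMap.intertwiningMap_of_isIntertwiningMap _ _ (s ∘ₗ f.toLinearMap) fun g v => by
    simp [f.isIntertwining, hs'], fun x => hs _⟩

/-- Postcomposition with an intertwining map. -/
def IntertwiningMap.linHomMap {B C : Type*} [AddCommGroup B] [Module k B] [AddCommGroup C]
    [Module k C] {σ : Representation k G B} {τ : Representation k G C} (μ : Representation k G M)
    (p : σ.IntertwiningMap τ) : IntertwiningMap (linHom μ σ) (linHom μ τ) :=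
  LinearMap.intertwiningMap_of_isIntertwiningMap _ _ (p.toLinearMap.compRight k) fun g f => by
    ext x
    simp [p.isIntertwining]

lemma IsFinSplit.linHomMap {B C : Type*} [AddCommGroup B] [Module k B] [AddCommGroup C]
    [Module k C] {σ : Representation k G B} {τ : Representation k G C} {p : σ.IntertwiningMap τ}
    (hp : IsFinSplit p) : IsFinSplit (p.linHomMap μ) := by
  intro K hK
  obtain ⟨s, hs, hs'⟩ := hp K hK
  refine ⟨s.compRight k, fun f => LinearMap.ext fun x => hs _, fun g hg f => ?_⟩
  ext x
  simp [hs' g hg]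

/-- Tensor-hom adjunction: `Hom_k(M, -)` preserves finitely split maps. -/
lemma IsFinProjective.tprod_right (hρ : IsFinProjective ρ) (μ : Representation k G M) :
    IsFinProjective (ρ.tprod μ) := by
  intro B C _ _ _ _ σ τ p hp f
  obtain ⟨l, hl⟩ := hρ (p.linHomMap μ) hp.linHomMap
    (LinearMap.intertwiningMap_of_isIntertwiningMap _ _ (TensorProduct.curry f.toLinearMap)
      fun g v => by
        ext x
        have := IntertwiningMap.isIntertwining _ _ f g (v ⊗ₜ μ g⁻¹ x)
        simpa using this)
  refine ⟨LinearMap.intertwiningMap_of_isIntertwiningMap _ _ (TensorProduct.lift l.toLinearMap)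
    fun g v => ?_, fun v => ?_⟩
  · induction v with
    | zero => simp
    | tmul x y => simp [l.isIntertwining]
    | add x y hx hy => simp only [map_add, hx, hy]
  · induction v with
    | zero => simp
    | tmul x y => exact LinearMap.congr_fun (hl x) y
    | add x y hx hy => simp only [map_add, hx, hy]

lemma IsFinProjective.tprod_left (hρ : IsFinProjective ρ) (μ : Representation k G M) :
    IsFinProjective (μ.tprod ρ) :=
  (hρ.tprod_right μ).of_equiv (TensorProduct.comm ρ μ)

/-- Schanuel's lemma for finitely split short exact sequences, in the form: the kernel of one
finitely projective cover is finitely projective as soon as the kernel of another one is. -/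
lemma IsFinProjective.of_schanuel {A' P' : Type u} [AddCommGroup A'] [Module k A']
    [AddCommGroup P'] [Module k P'] {α' : Representation k G A'} {ρ' : Representation k G P'}
    {i : α.IntertwiningMap ρ} {p : ρ.IntertwiningMap μ}
    (hi : Function.Injective i) (hip : Function.Exact i p) (hp : IsFinSplit p)
    {i' : α'.IntertwiningMap ρ'} {p' : ρ'.IntertwiningMap μ}
    (hi' : Function.Injective i') (hip' : Function.Exact i' p') (hp' : IsFinSplit p')
    (hα : IsFinProjective α) (hρ : IsFinProjective ρ) (hρ' : IsFinProjective ρ') :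
    IsFinProjective α' := by
  obtain ⟨φ, hφ⟩ := hρ' p hp p'
  obtain ⟨ψ, hψ⟩ := hρ p' hp' p
  obtain ⟨a, ha⟩ := IntertwiningMap.exists_comp_eq_of_exact hi hip (φ.comp i') fun x => by
    simp [hφ, hip'.apply_apply_eq_zero]
  obtain ⟨b, hb⟩ := IntertwiningMap.exists_comp_eq_of_exact hi' hip' (ψ.comp i) fun x => by
    simp [hψ, hip.apply_apply_eq_zero]
  obtain ⟨c, hc⟩ := IntertwiningMap.exists_comp_eq_of_exact hi' hip'
    (IntertwiningMap.id ρ' - ψ.comp φ) fun x => by simp [hψ, hφ]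
  -- This exhibits `A'` as a direct summand of `A ⊕ P'`.
  have key : ∀ x, b (a x) + c (i' x) = x := fun x => hi' (by simp [hb, hc, ha])
  intro B C _ _ _ _ σ τ q hq f
  obtain ⟨l, hl⟩ := hα q hq (f.comp b)
  obtain ⟨l', hl'⟩ := hρ' q hq (f.comp c)
  refine ⟨l.comp a + l'.comp i', fun x => ?_⟩
  calc q (l (a x) + l' (i' x)) = f (b (a x)) + f (c (i' x)) := by rw [map_add, hl, hl']; rfl
    _ = f x := by rw [← map_add, key]

end Projective

end Representation

/-- A choice of orbit representatives for a group acting through a homomorphism. -/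
lemma MulAction.exists_orbit_representatives {G Q X : Type*} [Group G] [Group Q] [MulAction Q X]
    (φ : G →* Q) : ∃ (r : X → X) (t : X → G),
      (∀ x, φ (t x) • r x = x) ∧ ∀ g x, r (φ g • x) = r x := by
  let _ : MulAction G X := MulAction.compHom X φ
  have h : ∀ x : X, ∃ g : G, g • (Quotient.mk (MulAction.orbitRel G X) x).out = x := fun x =>
    MulAction.mem_orbit_iff.1 ((MulAction.orbitRel G X).symm'
      (Quotient.mk_out (s := MulAction.orbitRel G X) x))
  choose t ht using h
  refine ⟨fun x => (Quotient.mk (MulAction.orbitRel G X) x).out, t, ht, fun g x => ?_⟩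
  exact congrArg Quotient.out
    (Quotient.sound (s := MulAction.orbitRel G X) (MulAction.mem_orbit x g))

namespace Representation

/-! ### Tensoring with permutation modules -/

section Permutation

variable {k : Type} [CommRing k] {G Q : Type*} [Group G] [Group Q]
variable {X M : Type u} [MulAction Q X] [AddCommGroup M] [Module k M]

lemma tprod_ofMulAction_induction {k X M : Type*} [CommRing k] [AddCommGroup M] [Module k M]
    {p : M ⊗[k] MonoidAlgebra k X → Prop} (h0 : p 0)
    (h1 : ∀ m x, p (m ⊗ₜ MonoidAlgebra.single x 1)) (hadd : ∀ v w, p v → p w → p (v + w)) (v) :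
    p v := by
  induction v with
  | zero => exact h0
  | add v w hv hw => exact hadd v w hv hw
  | tmul m a =>
    induction a using MonoidAlgebra.induction_linear with
    | zero => simpa using h0
    | add a b ha hb => simpa [TensorProduct.tmul_add] using hadd _ _ ha hb
    | single x r =>
      have : MonoidAlgebra.single x r = r • (MonoidAlgebra.single x 1 : MonoidAlgebra k X) := by
        simp
      rw [this, ← TensorProduct.smul_tmul]
      exact h1 _ _

/-- A tensor product with a permutation module is finitely projective as soon as the other factor
is finitely projective over all stabilizers. -/
lemma IsFinProjective.tprod_ofMulAction (φ : G →* Q) (μ : Representation k G M)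
    (h : ∀ x : X, IsFinProjective
      (μ.comp ((MulAction.stabilizer Q x).comap φ).subtype :
        Representation k ((MulAction.stabilizer Q x).comap φ) M)) :
    IsFinProjective (μ.tprod
      ((ofMulAction k Q X).comp φ : Representation k G (MonoidAlgebra k X))) := by
  intro B C _ _ _ _ σ τ p hp f
  obtain ⟨r, t, ht, hr⟩ := MulAction.exists_orbit_representatives (X := X) φ
  have hf : ∀ g m x, f (μ g m ⊗ₜ MonoidAlgebra.single (φ g • x) 1) =
      τ g (f (m ⊗ₜ MonoidAlgebra.single x 1)) := fun g m x => by
    rw [← IntertwiningMap.isIntertwining]; simp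
  have hl : ∀ x : X, ∃ l : M →ₗ[k] B, (∀ g, φ g • x = x → ∀ m, l (μ g m) = σ g (l m)) ∧
      ∀ m, p (l m) = f (m ⊗ₜ MonoidAlgebra.single x 1) := by
    intro x
    obtain ⟨l, hl⟩ := h x (p.pullback ((MulAction.stabilizer Q x).comap φ).subtype)
      (hp.pullback _) (LinearMap.intertwiningMap_of_isIntertwiningMap _ _
        (f.toLinearMap ∘ₗ (TensorProduct.mk k M (MonoidAlgebra k X)).flip (MonoidAlgebra.single x 1))
        fun g m => by
          have hg : φ g • x = x := g.2
          have := hf g m x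
          rw [hg] at this
          exact this)
    exact ⟨l.toLinearMap, fun g hg m => IntertwiningMap.isIntertwining _ _ l
      (⟨g, hg⟩ : (MulAction.stabilizer Q x).comap φ) m, hl⟩
  choose l hl hpl using hl
  -- The lift chosen at the orbit representative is transported to `x`; its invariance under the
  -- stabilizer makes the family equivariant.
  let e : X → M →ₗ[k] B := fun x => σ (t x) ∘ₗ l (r x) ∘ₗ μ (t x)⁻¹
  have he : ∀ g x m, e (φ g • x) (μ g m) = σ g (e x m) := by
    intro g x m
    have h1 : φ ((t (φ g • x))⁻¹ * g * t x) • r x = r x := by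
      rw [map_mul, map_mul, mul_smul, mul_smul, ht, map_inv, inv_smul_eq_iff, ← hr g x, ht]
    have h2 := hl (r x) _ h1 (μ (t x)⁻¹ m)
    simp only [e, LinearMap.comp_apply, hr]
    have h3 : μ ((t (φ g • x))⁻¹ * g * t x) (μ (t x)⁻¹ m) = μ (t (φ g • x))⁻¹ (μ g m) := by
      simp [map_mul]
    rw [← h3, h2]
    simp [map_mul]
  have hpe : ∀ x m, p (e x m) = f (m ⊗ₜ MonoidAlgebra.single x 1) := by
    intro x m
    simp only [e, LinearMap.comp_apply]
    rw [p.isIntertwining, hpl, ← hf, ht]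
    simp
  let F : M ⊗[k] MonoidAlgebra k X →ₗ[k] B := TensorProduct.lift
    (Finsupp.linearCombination k e ∘ₗ (MonoidAlgebra.coeffLinearEquiv k).toLinearMap).flip
  have hF : ∀ m x, F (m ⊗ₜ MonoidAlgebra.single x 1) = e x m := fun m x => by simp [F]
  refine ⟨LinearMap.intertwiningMap_of_isIntertwiningMap _ _ F fun g v => ?_, fun v => ?_⟩
  · induction v using tprod_ofMulAction_induction with
    | h0 => simp
    | h1 m x => simp [hF, he]
    | hadd v w hv hw => simp only [map_add, hv, hw]
  · induction v using tprod_ofMulAction_induction with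
    | h0 => simp
    | h1 m x => simp [hF, hpe]
    | hadd v w hv hw => simp only [map_add, hv, hw]

end Permutation

end Representation

namespace Representation

/-! ### The augmentation sequence of a permutation module -/

section Augmentation

variable {k : Type*} [CommRing k] {G H : Type*} [Group G] [Group H]
variable {X M : Type*} [MulAction G X] [AddCommGroup M] [Module k M]

variable (k G X) in
/-- The augmentation of a permutation module. -/
noncomputable def augmentation : (ofMulAction k G X).IntertwiningMap (trivial k G k) :=
  LinearMap.intertwiningMap_of_isIntertwiningMap _ _
    (Finsupp.linearCombination k (fun _ : X => (1 : k)) ∘ₗ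
      (MonoidAlgebra.coeffLinearEquiv k).toLinearMap) fun g v => by
    induction v using MonoidAlgebra.induction_linear with
    | zero => simp
    | add a b ha hb => simp only [map_add, ha, hb]
    | single x r => simp

@[simp]
lemma augmentation_single (x : X) (r : k) :
    augmentation k G X (MonoidAlgebra.single x r) = r := by
  simp [augmentation]

variable (k G X) in
/-- The kernel of the augmentation of a permutation module. -/
noncomputable abbrev augmentationKer :
    Representation k G (augmentation k G X).ker.toSubmodule :=
  (augmentation k G X).ker.toRepresentation

variable (k X) in
/-- The tensor product of a representation with the augmentation of a permutation module. -/
noncomputable def augMap (φ : H →* G) (μ : Representation k H M) :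
    IntertwiningMap (μ.tprod ((ofMulAction k G X).comp φ :
      Representation k H (MonoidAlgebra k X))) μ :=
  LinearMap.intertwiningMap_of_isIntertwiningMap _ _
    ((_root_.TensorProduct.rid k M).toLinearMap ∘ₗ (augmentation k G X).toLinearMap.lTensor M)
    fun g v => by
      induction v using tprod_ofMulAction_induction with
      | h0 => simp
      | h1 m x => simp
      | hadd v w hv hw => simp only [map_add, hv, hw]

@[simp]
lemma augMap_tmul_single (φ : H →* G) (μ : Representation k H M) (m : M) (x : X) :
    augMap k X φ μ (m ⊗ₜ MonoidAlgebra.single x 1) = m := by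
  simp [augMap]

variable (k X) in
/-- The tensor product of a representation with the inclusion of the augmentation kernel. -/
noncomputable def augIncl (φ : H →* G) (μ : Representation k H M) :
    IntertwiningMap
      (μ.tprod ((augmentationKer k G X).comp φ :
        Representation k H (augmentation k G X).ker.toSubmodule))
      (μ.tprod ((ofMulAction k G X).comp φ : Representation k H (MonoidAlgebra k X))) :=
  LinearMap.intertwiningMap_of_isIntertwiningMap _ _
    ((augmentation k G X).ker.toSubmodule.subtype.lTensor M) fun g v => by
      induction v with
      | zero => simp
      | tmul x y => rfl
      | add x y hx hy => simp only [map_add, hx, hy]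

lemma augIncl_injective [Nonempty X] (φ : H →* G) (μ : Representation k H M) :
    Function.Injective (augIncl k X φ μ) := by
  obtain ⟨x⟩ := ‹Nonempty X›
  -- The linear retraction `v ↦ v - ε(v)x` keeps the inclusion injective after tensoring, with no
  -- flatness of `M`.
  let r : MonoidAlgebra k X →ₗ[k] (augmentation k G X).ker.toSubmodule :=
    LinearMap.codRestrict _ (LinearMap.id -
      (LinearMap.toSpanSingleton k _ (MonoidAlgebra.single x 1)) ∘ₗ
        (augmentation k G X).toLinearMap) fun v => by
      simp
  have hr : r ∘ₗ (augmentation k G X).ker.toSubmodule.subtype = LinearMap.id := by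
    ext v
    have : augmentation k G X v = 0 := v.2
    simp [r, this]
  refine Function.LeftInverse.injective (g := r.lTensor M) fun v => ?_
  change (r.lTensor M ∘ₗ (augmentation k G X).ker.toSubmodule.subtype.lTensor M) v = v
  rw [← LinearMap.lTensor_comp, hr, LinearMap.lTensor_id, LinearMap.id_apply]

lemma augIncl_exact [Nonempty X] (φ : H →* G) (μ : Representation k H M) :
    Function.Exact (augIncl k X φ μ) (augMap k X φ μ) := by
  obtain ⟨x⟩ := ‹Nonempty X›
  have h := lTensor_exact M (f := (augmentation k G X).ker.toSubmodule.subtype)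
    (g := (augmentation k G X).toLinearMap) (fun v => by simp)
    fun r => ⟨MonoidAlgebra.single x r, augmentation_single x r⟩
  exact fun v => ((_root_.TensorProduct.rid k M).map_eq_zero_iff).trans (h v)

/-- A point `x` fixed by `K` gives the `K`-equivariant section `m ↦ m ⊗ x`. -/
lemma augMap_isFinSplit (φ : H →* G) (μ : Representation k H M)
    (h : ∀ K : Subgroup H, Finite K → ∃ x : X, ∀ g ∈ K, φ g • x = x) :
    IsFinSplit (augMap k X φ μ) := by
  intro K hK
  obtain ⟨x, hx⟩ := h K hK
  exact ⟨(TensorProduct.mk k M (MonoidAlgebra k X)).flip (MonoidAlgebra.single x 1),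
    fun m => by simp, fun g hg m => by simp [hx g hg]⟩

end Augmentation

/-! ### Powers of the augmentation kernel and dimension shifting -/

section FinCosets

variable {k : Type} [CommRing k] {G H : Type u} [Group G] [Group H] {M : Type u}
  [AddCommGroup M] [Module k M]

lemma exists_finCosets_smul_eq (φ : H →* G) (K : Subgroup H) (hK : Finite K) :
    ∃ x : FinCosets G, ∀ g ∈ K, φ g • x = x := by
  refine ⟨⟨⟨K.map φ, (Set.toFinite (K : Set H)).image φ⟩, (1 : G)⟩, fun g hg => ?_⟩
  refine Sigma.ext rfl (heq_of_eq ?_)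
  change ((φ g • (1 : G) : G) : G ⧸ K.map φ) = ((1 : G) : G ⧸ K.map φ)
  rw [QuotientGroup.eq]
  simpa using ⟨g, hg, rfl⟩

instance : Nonempty (FinCosets G) :=
  (exists_finCosets_smul_eq (MonoidHom.id G) ⊥ inferInstance).nonempty

lemma finite_stabilizer_finCosets (x : FinCosets G) : Finite (MulAction.stabilizer G x) := by
  obtain ⟨⟨K, hK⟩, q⟩ := x
  induction q using QuotientGroup.induction_on with
  | H a =>
    have : ∀ g ∈ MulAction.stabilizer G (⟨⟨K, hK⟩, (a : G ⧸ K)⟩ : FinCosets G),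
        a⁻¹ * g * a ∈ K := by
      intro g hg
      have h1 : ((g * a : G) : G ⧸ K) = a :=
        eq_of_heq (Sigma.mk.inj (MulAction.mem_stabilizer_iff.1 hg)).2
      have h2 := QuotientGroup.eq.1 h1.symm
      simpa [mul_assoc] using h2
    refine Finite.of_injective (fun g => (⟨_, this g g.2⟩ : K)) fun g h hgh => ?_
    simpa using hgh

/-- Over a group mapping injectively to `G`, the tensor product of any representation with the
standard permutation module of `G` is finitely projective. -/
lemma IsFinProjective.tprod_finCosets (φ : H →* G) (hφ : Function.Injective φ)
    (μ : Representation k H M) : IsFinProjective (μ.tprod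
      ((ofMulAction k G (FinCosets G)).comp φ :
        Representation k H (MonoidAlgebra k (FinCosets G)))) := by
  refine IsFinProjective.tprod_ofMulAction φ μ fun x => ?_
  have := finite_stabilizer_finCosets x
  have : Finite ((MulAction.stabilizer G x).comap φ) :=
    Finite.of_injective (fun g => (⟨φ g, g.2⟩ : MulAction.stabilizer G x)) fun g h hgh =>
      Subtype.ext (hφ (congrArg Subtype.val hgh))
  exact .of_finite _

variable (k G) in
/-- The tensor powers of the augmentation kernel of the standard permutation module. -/
noncomputable def syzygyPow : ℕ → Rep.{u} k G
  | 0 => Rep.trivial k G (ULift.{u} k)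
  | n + 1 => Rep.of ((syzygyPow n).ρ.tprod (augmentationKer k G (FinCosets G)))

variable (k) in
/-- The tensor powers of the augmentation kernel, pulled back along a homomorphism. -/
noncomputable abbrev syzygyRes (φ : H →* G) (n : ℕ) : Representation k H (syzygyPow k G n) :=
  (syzygyPow k G n).ρ.comp φ

/-- Dimension shifting along a finitely split short exact sequence. -/
lemma IsFinProjective.syzygyRes_succ {A P : Type u} [AddCommGroup A] [Module k A]
    [AddCommGroup P] [Module k P] {α : Representation k H A} {ρ : Representation k H P}
    {μ : Representation k H M} {i : α.IntertwiningMap ρ} {p : ρ.IntertwiningMap μ}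
    (hi : Function.Injective i) (hip : Function.Exact i p) (hp : IsFinSplit p)
    (φ : H →* G) (hφ : Function.Injective φ) {n : ℕ}
    (hα : IsFinProjective (α.tprod (syzygyRes k φ n)))
    (hρ : IsFinProjective (ρ.tprod (syzygyRes k φ n))) :
    IsFinProjective (μ.tprod (syzygyRes k φ (n + 1))) := by
  let T := syzygyRes k φ n
  obtain ⟨s, hs⟩ := hp.exists_section
  obtain ⟨r, hr⟩ := ((Function.Exact.split_tfae (f := i.toLinearMap) (g := p.toLinearMap)
    hip hi hp.surjective).out 0 1 : (∃ l, p.toLinearMap ∘ₗ l = .id) ↔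
      ∃ l, l ∘ₗ i.toLinearMap = .id).1 ⟨s, LinearMap.ext hs⟩
  have h := IsFinProjective.of_schanuel (i := i.rTensor T) (p := p.rTensor T)
    (i' := augIncl k (FinCosets G) φ (μ.tprod T)) (p' := augMap k (FinCosets G) φ (μ.tprod T))
    (Function.LeftInverse.injective (g := r.rTensor _) fun v => by
      change (r.rTensor _ ∘ₗ i.toLinearMap.rTensor _) v = v
      rw [← LinearMap.rTensor_comp, hr, LinearMap.rTensor_id, LinearMap.id_apply])
    (rTensor_exact _ (f := i.toLinearMap) (g := p.toLinearMap) hip hp.surjective) hp.rTensor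
    (augIncl_injective φ _) (augIncl_exact φ _)
    (augMap_isFinSplit φ _ (exists_finCosets_smul_eq φ)) hα hρ
    (.tprod_finCosets φ hφ _)
  exact h.of_equiv (TensorProduct.assoc μ T _)

end FinCosets

end Representation

open Representation


namespace Representation

section Equivs

variable {k : Type*} [CommRing k] {G : Type*} [Group G] {U V W : Type*} [AddCommGroup U]
  [Module k U] [AddCommGroup V] [Module k V] [AddCommGroup W] [Module k W]

/-- Swapping the last two factors of a triple tensor product of representations. -/
noncomputable def tprodRightComm (ρ : Representation k G U) (σ : Representation k G V)
    (τ : Representation k G W) : ((ρ.tprod σ).tprod τ).Equiv ((ρ.tprod τ).tprod σ) :=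
  .mk (_root_.TensorProduct.rightComm k U V W) fun g => by ext; simp

/-- The unit isomorphism for the tensor product with a free trivial representation of rank one. -/
noncomputable def tprodTrivial (e : V ≃ₗ[k] k) (ρ : Representation k G U) :
    (ρ.tprod (trivial k G V)).Equiv ρ :=
  .mk ((e.lTensor U).trans (_root_.TensorProduct.rid k U)) fun g => by ext; simp

end Equivs

section FinCosets

variable {k : Type} [CommRing k] {G H Q : Type u} [Group G] [Group H] [Group Q] {M : Type u}
  [AddCommGroup M] [Module k M]

lemma IsFinProjective.syzygyRes_add {μ : Representation k H M} {φ : H →* G} {n : ℕ}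
    (h : IsFinProjective (μ.tprod (syzygyRes k φ n))) (a : ℕ) :
    IsFinProjective (μ.tprod (syzygyRes k φ (n + a))) := by
  induction a with
  | zero => exact h
  | succ a ih =>
    let J : Representation k H (augmentation k G (FinCosets G)).ker.toSubmodule :=
      (augmentationKer k G (FinCosets G)).comp φ
    have h1 : IsFinProjective ((μ.tprod (syzygyRes k φ (n + a))).tprod J) := ih.tprod_right J
    exact h1.of_equiv (TensorProduct.assoc μ (syzygyRes k φ (n + a)) J)

end FinCosets

end Representation

/-! ### `𝔉`-resolutions and the extension inequality -/

section Resolution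

variable {k : Type} [CommRing k] {G H Q : Type u} [Group G] [Group H] [Group Q]

lemma isFinProjective_tensorPerm (M : Rep.{u} k G) : IsFinProjective (tensorPerm M).ρ :=
  .tprod_finCosets (MonoidHom.id G) Function.injective_id M.ρ

lemma isFProjective_iff (P : Rep.{u} k G) : IsFProjective P ↔ IsFinProjective P.ρ := by
  constructor
  · rintro ⟨M, ⟨r⟩⟩
    refine (isFinProjective_tensorPerm M).of_retract r.i.hom r.r.hom fun x => ?_
    have := r.retract
    rw [← Rep.comp_apply, this, Rep.id_apply]
  · intro h
    obtain ⟨l, hl⟩ := h (augMap k (FinCosets G) (MonoidHom.id G) P.ρ)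
      (augMap_isFinSplit _ _ (exists_finCosets_smul_eq _)) (.id P.ρ)
    exact ⟨P, ⟨⟨Rep.ofHom l, Rep.ofHom (augMap k (FinCosets G) (MonoidHom.id G) P.ρ), by
      ext x
      exact hl x⟩⟩⟩

/-- For `x ∈ Δ` fixed by `K`, put `c ⊗ x` into the section over `kΔ` and augment. -/
lemma IsFSplit.isFinSplit {A B C : Rep.{u} k G} {i : A ⟶ B} {p : B ⟶ C} (h : IsFSplit i p) :
    IsFinSplit p.hom := by
  obtain ⟨-, -, -, s, hs⟩ := h
  intro K hK
  obtain ⟨x, hx⟩ := exists_finCosets_smul_eq (MonoidHom.id G) K hK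
  have hs' : ∀ v, (tensorPermMap p).hom (s.hom v) = v := fun v => by
    rw [← Rep.comp_apply, hs, Rep.id_apply]
  have hnat : ∀ v, p.hom (augMap k (FinCosets G) (MonoidHom.id G) B.ρ v) =
      augMap k (FinCosets G) (MonoidHom.id G) C.ρ ((tensorPermMap p).hom v) := fun v => by
    induction v using tprod_ofMulAction_induction with
    | h0 => simp
    | h1 m x =>
      rw [augMap_tmul_single]
      exact (augMap_tmul_single _ C.ρ (p.hom m) x).symm
    | hadd v w hv hw => simp only [map_add, hv, hw]
  refine ⟨(augMap k (FinCosets G) (MonoidHom.id G) B.ρ).toLinearMap ∘ₗ s.hom.toLinearMap ∘ₗ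
    (TensorProduct.mk k C (MonoidAlgebra k (FinCosets G))).flip (MonoidAlgebra.single x 1),
    fun c => ?_, fun g hg c => ?_⟩
  · refine (hnat _).trans ?_
    exact (congrArg _ (hs' _)).trans (augMap_tmul_single _ C.ρ c x)
  · have h1 : (tensorPerm C).ρ g (c ⊗ₜ MonoidAlgebra.single x 1) =
        C.ρ g c ⊗ₜ MonoidAlgebra.single x 1 := by
      have := hx g hg
      simp only [MonoidHom.id_apply] at this
      simp [this]
    change augMap k (FinCosets G) (MonoidHom.id G) B.ρ
      (s.hom (C.ρ g c ⊗ₜ MonoidAlgebra.single x 1)) = _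
    rw [← h1, Rep.hom_comm_apply]
    exact IntertwiningMap.isIntertwining _ _ (augMap k (FinCosets G) (MonoidHom.id G) B.ρ) g _

lemma Representation.IsFinSplit.isFSplit {A B C : Rep.{u} k G} {i : A ⟶ B} {p : B ⟶ C}
    (hi : Function.Injective i.hom) (hip : Function.Exact i.hom p.hom) (hp : IsFinSplit p.hom) :
    IsFSplit i p := by
  -- `C ⊗ kΔ` is finitely projective, so its identity lifts.
  obtain ⟨l, hl⟩ := isFinProjective_tensorPerm C (tensorPermMap p).hom hp.rTensor (.id _)
  refine ⟨hi, hip, hp.surjective, Rep.ofHom l, ?_⟩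
  apply Rep.hom_ext
  apply IntertwiningMap.ext
  exact LinearMap.ext hl

/-- If the tensor product of every `𝔉`-projective module, inflated along `π`, with the `n`-th
power of the augmentation kernel is finitely projective, then dimension shifting along an
`𝔉`-projective resolution of length `a` makes the `n + a`-th power do so for the resolved
module. -/
lemma HasFResolution.isFinProjective_tprod (φ : H →* G) (hφ : Function.Injective φ) (π : H →* Q)
    (n : ℕ) (h : ∀ P : Rep.{u} k Q, IsFProjective P → IsFinProjective
      (Representation.tprod (P.ρ.comp π) (syzygyRes k φ n)))
    {a : ℕ} {M : Rep.{u} k Q} (hM : HasFResolution a M) : IsFinProjective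
      (Representation.tprod (M.ρ.comp π) (syzygyRes k φ (n + a))) := by
  induction a generalizing M with
  | zero => exact h M hM
  | succ a ih =>
    obtain ⟨K, P, i, p, hip, hP, hK⟩ := hM
    exact IsFinProjective.syzygyRes_succ (i := i.hom.pullback π) (p := p.hom.pullback π)
      hip.1 hip.2.1 (hip.isFinSplit.pullback π) φ hφ (ih hK) ((h P hP).syzygyRes_add a)

lemma HasFResolution.of_isFinProjective {a : ℕ} {M : Rep.{u} k G}
    (h : IsFinProjective (M.ρ.tprod (syzygyPow k G a).ρ)) : HasFResolution a M := by
  induction a generalizing M with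
  | zero => exact (isFProjective_iff M).2 (h.of_equiv (tprodTrivial ULift.moduleEquiv M.ρ))
  | succ a ih =>
    refine ⟨Rep.of (M.ρ.tprod (augmentationKer k G (FinCosets G))), tensorPerm M,
      Rep.ofHom (augIncl k (FinCosets G) (MonoidHom.id G) M.ρ),
      Rep.ofHom (augMap k (FinCosets G) (MonoidHom.id G) M.ρ),
      IsFinSplit.isFSplit (augIncl_injective _ _) (augIncl_exact _ _)
        (augMap_isFinSplit _ _ (exists_finCosets_smul_eq _)),
      (isFProjective_iff _).2 (isFinProjective_tensorPerm M), ih ?_⟩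
    -- One factor `J` is moved next to `M`, so that `M ⊗ J` becomes the new module.
    exact (h.of_equiv (Representation.TensorProduct.assoc M.ρ (syzygyPow k G a).ρ _).symm).of_equiv
      (tprodRightComm M.ρ (syzygyPow k G a).ρ _)

lemma fpd_le_iff {M : Rep.{u} k G} {n : ℕ} : fpd M ≤ n ↔ ∃ a ≤ n, HasFResolution a M := by
  constructor
  · intro h
    by_contra! hn
    have : ((n + 1 : ℕ) : ℕ∞) ≤ fpd M := le_iInf₂ fun a ha => by
      by_contra hlt
      exact hn a (Nat.lt_succ_iff.1 (by exact_mod_cast not_le.1 hlt)) ha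
    have := this.trans h
    norm_cast at this
    omega
  · rintro ⟨a, ha, hM⟩
    exact (iInf₂_le a hM).trans (by exact_mod_cast ha)

/-- If the trivial module of a subgroup has `𝔉`-projective dimension at most `n`, the `n`-th
power of the augmentation kernel of the ambient group is finitely projective. -/
lemma isFinProjective_syzygyRes_of_fpd_trivial_le {V : Type u} [AddCommGroup V] [Module k V]
    (e : V ≃ₗ[k] k) (φ : H →* G) (hφ : Function.Injective φ) {n : ℕ}
    (h : fpd (Rep.trivial k H V) ≤ n) : IsFinProjective (syzygyRes k φ n) := by
  obtain ⟨a, han, ha⟩ := fpd_le_iff.1 h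
  have h0 := ha.isFinProjective_tprod φ hφ (MonoidHom.id H) 0 fun P hP =>
    ((isFProjective_iff P).1 hP).tprod_right (syzygyRes k φ 0)
  rw [Nat.zero_add] at h0
  -- The resolution may be shorter than `n`; further factors `J` preserve projectivity.
  have h1 := h0.syzygyRes_add (n - a)
  rw [Nat.add_sub_cancel' han] at h1
  exact (h1.of_equiv (Representation.TensorProduct.comm (trivial k H V) (syzygyRes k φ n))).of_equiv
    (tprodTrivial e (syzygyRes k φ n))

/-- The tensor product of an inflated `𝔉`-projective module with a representation that is finitely
projective over the preimages of finite subgroups is finitely projective. -/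
lemma IsFProjective.tprod_of_stabilizers {P : Rep.{u} k Q} (hP : IsFProjective P) (π : G →* Q)
    {L : Type u} [AddCommGroup L] [Module k L] (τ : Representation k G L)
    (hτ : ∀ x : FinCosets Q, IsFinProjective
      (τ.comp ((MulAction.stabilizer Q x).comap π).subtype :
        Representation k ((MulAction.stabilizer Q x).comap π) L)) :
    IsFinProjective (Representation.tprod (P.ρ.comp π) τ) := by
  obtain ⟨M, ⟨r⟩⟩ := hP
  let μ : Representation k G M := M.ρ.comp π
  let δ : Representation k G (MonoidAlgebra k (FinCosets Q)) :=
    (ofMulAction k Q (FinCosets Q)).comp π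
  have h : IsFinProjective ((μ.tprod τ).tprod δ) :=
    .tprod_ofMulAction π (μ.tprod τ) fun x => (hτ x).tprod_left
      (μ.comp ((MulAction.stabilizer Q x).comap π).subtype)
  have h' : IsFinProjective ((μ.tprod δ).tprod τ) := h.of_equiv (tprodRightComm μ τ δ)
  let i : IntertwiningMap (P.ρ.comp π) (μ.tprod δ) := r.i.hom.pullback π
  let q : IntertwiningMap (μ.tprod δ) (P.ρ.comp π) := r.r.hom.pullback π
  have hr : ∀ x, q (i x) = x := fun x => by
    change r.r.hom (r.i.hom x) = x
    rw [← Rep.comp_apply, r.retract, Rep.id_apply]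
  refine h'.of_retract (i.rTensor τ) (q.rTensor τ) fun v => ?_
  induction v with
  | zero => simp
  | tmul x y => exact congrArg (· ⊗ₜ y) (hr x)
  | add x y hx hy => simp only [map_add, hx, hy]

/-- The extension inequality for `𝔉`-projective dimensions of trivial modules, over an arbitrary
coefficient ring. -/
theorem fpd_trivial_le_of_groupExtension {V : Type u} [AddCommGroup V] [Module k V]
    (e : V ≃ₗ[k] k) {N : Type u} [Group N] (E : GroupExtension N G Q) (m n : ℕ)
    (hQ : fpd (Rep.trivial k Q V) ≤ m)
    (hN : ∀ H : Subgroup G, E.inl.range ≤ H → E.inl.range.IsFiniteRelIndex H →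
      fpd (Rep.trivial k H V) ≤ n) :
    fpd (Rep.trivial k G V) ≤ n + m := by
  obtain ⟨a, ham, ha⟩ := fpd_le_iff.1 hQ
  have hstab : ∀ x : FinCosets Q,
      fpd (Rep.trivial k ((MulAction.stabilizer Q x).comap E.rightHom) V) ≤ n := fun x => by
    have hx := finite_stabilizer_finCosets x
    refine hN _ ?_ ?_
    · rw [E.range_inl_eq_ker_rightHom]
      exact MonoidHom.ker_le_comap _ _
    -- The index of `N` in the preimage is the order of the finite stabilizer.
    · rw [Subgroup.isFiniteRelIndex_iff_relIndex_ne_zero, E.range_inl_eq_ker_rightHom,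
        Subgroup.relIndex_ker, Subgroup.map_comap_eq_self_of_surjective E.rightHom_surjective]
      exact Nat.card_pos.ne'
  have hG := ha.isFinProjective_tprod (MonoidHom.id G) Function.injective_id E.rightHom n
    fun P hP => hP.tprod_of_stabilizers E.rightHom _ fun x =>
      isFinProjective_syzygyRes_of_fpd_trivial_le e
        ((MulAction.stabilizer Q x).comap E.rightHom).subtype
        (Subgroup.subtype_injective _) (hstab x)
  refine le_trans (fpd_le_iff.2 ⟨n + a, le_rfl, .of_isFinProjective hG⟩) ?_
  exact_mod_cast Nat.add_le_add_left ham n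

end Resolution

theorem mainTheorem7 {N G Q : Type u} [Group N] [Group G] [Group Q]
    (E : GroupExtension N G Q) (m n : ℕ) (hQ : fcd Q ≤ m)
    (hN : ∀ H : Subgroup G, E.inl.range ≤ H → E.inl.range.IsFiniteRelIndex H → fcd H ≤ n) :
    fcd G ≤ n + m := by
  exact fpd_trivial_le_of_groupExtension ULift.moduleEquiv E m n hQ hN
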